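/- Let $d,k\ge 1$ be integers. Let $(s_i)_{i\ge 1}$ be the Sylvester sequence, $s_1=2$ and $s_i=1+s_1s_2\cdots s_{i-1}$ for $i\ge 2$. Let $\mathcal S^d(k)$ be the family of all $d$-dimensional lattice simplices in $\mathbb R^d$ (convex hulls of $d+1$ affinely independent points of $\mathbb Z^d$) that contain exactly $k$ points of $\mathbb Z^d$ in their interior. Then every $S\in\mathcal S^d(k)$ satisfies $$\operatorname{vol}(S)\le k(d+1)\frac{(s_d-1)^2}{d!},$$ where $\operatorname{vol}$ is the Lebesgue measure on $\mathbb R^d$. The maximum $s(d,k):=\max\{\operatorname{vol}(S): S\in\mathcal S^d(k)\}$ exists, and $$s(d,k)\le k(d+1)\frac{(s_d-1)^2}{d!}.$$ Moreover, the Zaks--Perles--Wills simplex $S_{d,k}:=\operatorname{conv}\bigl(0,\,s_1e_1,\ldots,s_{d-1}e_{d-1},\,(k+1)(s_d-1)e_d\bigr)$, where $e_1,\ldots,e_d$ is the standard basis of $\mathbb R^d$, belongs to $\mathcal S^d(k)$ and has volume $(k+1)(s_d-1)^2/d!$, and $$\operatorname{vol}(S_{d,k})\le s(d,k)\le (d+1)\operatorname{vol}(S_{d,k}).$$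 -/

import Mathlib

open MeasureTheory

/-- The Sylvester sequence, indexed from `1`: `s 1 = 2` and `s i = 1 + s 1 * ⋯ * s (i - 1)` for
`i ≥ 2`. The value at index `0` is irrelevant. -/
def sylvester (i : ℕ) : ℕ := 1 + ∏ j : Fin (i - 1), sylvester (j + 1)
termination_by i
decreasing_by have := j.isLt; omega

theorem sylvester_one : sylvester 1 = 2 := by
  rw [sylvester]; simp

theorem sylvester_eq (i : ℕ) : sylvester i = 1 + ∏ j ∈ Finset.Icc 1 (i - 1), sylvester j := by
  rw [sylvester, Fin.prod_univ_eq_prod_range (fun j => sylvester (j + 1)),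
    Finset.range_eq_Ico, Finset.prod_Ico_add' sylvester 0 (i - 1) 1]
  rfl

/-- The lattice `ℤ^d` inside `ℝ^d`. -/
def latticePoints (d : ℕ) : Set (Fin d → ℝ) := Set.range fun (z : Fin d → ℤ) i => (z i : ℝ)

/-- `S` is a `d`-dimensional lattice simplex in `ℝ^d`: the convex hull of `d + 1` affinely
independent lattice points (affine independence is part of `Affine.Simplex`). -/
def IsLatticeSimplex {d : ℕ} (S : Set (Fin d → ℝ)) : Prop :=
  ∃ T : Affine.Simplex ℝ (Fin d → ℝ) d,
    (∀ i, T.points i ∈ latticePoints d) ∧ S = convexHull ℝ (Set.range T.points)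

/-- The family of all `d`-dimensional lattice simplices in `ℝ^d` having exactly `k` lattice points
in their interior. -/
def latticeSimplices (d k : ℕ) : Set (Set (Fin d → ℝ)) :=
  {S | IsLatticeSimplex S ∧ (interior S ∩ latticePoints d).encard = k}

/-- The set of the volumes (Lebesgue measures) of the members of `latticeSimplices d k`. -/
noncomputable def simplexVolumes (d k : ℕ) : Set ℝ :=
  (fun S => volume.real S) '' latticeSimplices d k

/-- `s(d,k)`: the maximum (as a supremum; that it is attained has to be stated separately) of the
volumes of the members of `latticeSimplices d k`. -/
noncomputable def maxSimplexVolume (d k : ℕ) : ℝ := sSup (simplexVolumes d k)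

/-- The Zaks--Perles--Wills simplex
`conv (0, s₁ e₁, …, s_{d-1} e_{d-1}, (k + 1) (s_d - 1) e_d)`. The coordinate with index `i : Fin d`
is the `(i + 1)`-st one. -/
def zpwSimplex (d k : ℕ) : Set (Fin d → ℝ) :=
  convexHull ℝ (insert 0 (Set.range fun i : Fin d =>
    (Pi.single i (if (i : ℕ) + 1 = d then ((k : ℝ) + 1) * ((sylvester d : ℝ) - 1)
      else (sylvester (i + 1) : ℝ)) : Fin d → ℝ)))

/-! Write P_n = s_1⋯s_n = s_{n+1} - 1. Among the interior lattice points of S choose x whose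
smallest barycentric coordinate m is maximal, and order its coordinates as β_1 ≥ ⋯ ≥ β_{d+1} = m.

Volume against coordinates (`AffineBasis.abs_det_edgeMatrix_mul_prod_coord_le`): if d! vol(S)
β_1⋯β_d exceeded k, Blichfeldt's theorem for a box with sides β_1, …, β_d in barycentric coordinates
would give k + 1 points congruent modulo the lattice. Their differences from a suitable one of them,
added to x, would be k + 1 interior lattice points.

Product-sum inequality (`AffineBasis.prod_coord_sub_le`): with a_i = β_i - m, a_1⋯a_j ≤ 1 - (a_1 + ⋯
+ a_j) for j ≤ d. Otherwise Diophantine approximation moves x to a lattice point all of whose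
coordinates exceed m.

These inequalities bound the partial sums of a by those of 1/s_i (`sum_range_le_of_prod_le`). By
majorization β_1⋯β_d is then at least the product of an extremal sequence: N Sylvester reciprocals
shifted by m, one remainder, and copies of m. Log-concavity in m reduces its estimate to two
endpoints, and the growth of P_n gives β_1⋯β_d ≥ 1/((d+1) P_{d-1}²) (`inv_le_prod_add`), hence the
bound.

The maximum exists because volumes are bounded and lie in (1/d!)ℕ. -/

/-! ### The Sylvester sequence -/

/-- The product of the first `n` terms of the Sylvester sequence. -/
def sylvesterProd (n : ℕ) : ℕ := ∏ i ∈ Finset.range n, sylvester (i + 1)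

theorem sylvester_succ (n : ℕ) : sylvester (n + 1) = 1 + sylvesterProd n := by
  rw [sylvester_eq, sylvesterProd, Finset.range_eq_Ico, Finset.prod_Ico_add' sylvester 0 n 1]
  rfl

theorem sylvesterProd_zero : sylvesterProd 0 = 1 := by simp [sylvesterProd]

theorem sylvesterProd_succ (n : ℕ) :
    sylvesterProd (n + 1) = sylvesterProd n * (1 + sylvesterProd n) := by
  rw [← sylvester_succ, sylvesterProd, Finset.prod_range_succ, ← sylvesterProd]

theorem succ_le_sylvesterProd (n : ℕ) : n + 1 ≤ sylvesterProd n := by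
  induction n with
  | zero => simp [sylvesterProd_zero]
  | succ n ih => rw [sylvesterProd_succ]; nlinarith

theorem sylvesterProd_pos (n : ℕ) : (0 : ℝ) < sylvesterProd n := by
  exact_mod_cast (Nat.succ_pos n).trans_le (succ_le_sylvesterProd n)

theorem sylvester_cast_pos (n : ℕ) : (0 : ℝ) < sylvester (n + 1) := by
  rw [sylvester_succ]; positivity

theorem sum_inv_sylvester (n : ℕ) :
    ∑ i ∈ Finset.range n, (1 : ℝ) / sylvester (i + 1) = 1 - 1 / sylvesterProd n := by
  induction n with
  | zero => simp [sylvesterProd_zero]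
  | succ n ih =>
    rw [Finset.sum_range_succ, ih, sylvester_succ, sylvesterProd_succ]
    have := sylvesterProd_pos n
    push_cast
    field_simp
    ring

theorem prod_inv_sylvester (n : ℕ) :
    ∏ i ∈ Finset.range n, (1 : ℝ) / sylvester (i + 1) = 1 / sylvesterProd n := by
  simp [sylvesterProd]

/-- With p = P_n this is the factor needed in the inductive step of `sylvesterProd_pow_le`. -/
theorem mul_le_succ_pow {p n : ℕ} (hp : n + 1 ≤ p) (r : ℕ) :
    p * (n + r + 3) ≤ (p + 1) ^ (r + 2) := by
  induction r with
  | zero =>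
    calc p * (n + 0 + 3) ≤ p * (p + 2) := Nat.mul_le_mul_left _ (by omega)
      _ ≤ (p + 1) ^ (0 + 2) := by rw [zero_add]; nlinarith
  | succ r ih =>
    calc p * (n + (r + 1) + 3) ≤ (p * (n + r + 3)) * (p + 1) := by
          have : n + (r + 1) + 3 ≤ (n + r + 3) * (p + 1) := by nlinarith
          calc _ ≤ p * ((n + r + 3) * (p + 1)) := Nat.mul_le_mul_left _ this
            _ = _ := by ring
      _ ≤ (p + 1) ^ (r + 2) * (p + 1) := Nat.mul_le_mul_right _ ih
      _ = _ := by ring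

/-- The growth of the Sylvester sequence beats the factors occurring in the volume bound. -/
theorem sylvesterProd_pow_le (n r : ℕ) :
    sylvesterProd n ^ (r + 2) * (n + r + 2) ^ r ≤ sylvesterProd (n + r) ^ 2 := by
  induction r generalizing n with
  | zero => simp
  | succ r ih =>
    -- Passing from (n, r + 1) to (n + 1, r) keeps the right-hand side fixed, and P_{n+1} = P_n (P_n
    -- + 1) supplies the power (P_n + 1)^(r+2).
    have h := ih (n + 1)
    have h2 := mul_le_succ_pow (succ_le_sylvesterProd n) r
    rw [show n + 1 + r = n + (r + 1) by ring] at h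
    refine le_trans ?_ h
    rw [sylvesterProd_succ]
    calc sylvesterProd n ^ (r + 1 + 2) * (n + (r + 1) + 2) ^ (r + 1)
        = sylvesterProd n ^ (r + 2) * (n + r + 3) ^ r * (sylvesterProd n * (n + r + 3)) := by ring
      _ ≤ sylvesterProd n ^ (r + 2) * (n + r + 3) ^ r * (sylvesterProd n + 1) ^ (r + 2) :=
          Nat.mul_le_mul_left _ h2
      _ = _ := by rw [mul_pow]; ring

/-! ### Majorization -/

/-- Summation by parts against the nondecreasing weights 1/x_i turns the partial-sum conditions into
∑ (u_i/x_i - 1) ≤ 0; then u_i ≤ x_i exp(u_i/x_i - 1) bounds the product. -/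
theorem prod_range_le_prod_range_of_sum_le {n : ℕ} {x u : ℕ → ℝ} (hx : ∀ i < n, 0 < x i)
    (hanti : ∀ i, i + 1 < n → x (i + 1) ≤ x i) (hu : ∀ i < n, 0 ≤ u i)
    (hD : ∀ l < n, ∑ i ∈ Finset.range l, x i ≤ ∑ i ∈ Finset.range l, u i)
    (hn : ∑ i ∈ Finset.range n, u i ≤ ∑ i ∈ Finset.range n, x i) :
    ∏ i ∈ Finset.range n, u i ≤ ∏ i ∈ Finset.range n, x i := by
  have abel : ∀ l, l < n → (∑ i ∈ Finset.range (l + 1), (x i - u i)) / x l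
      ≤ ∑ i ∈ Finset.range (l + 1), (x i - u i) / x i := by
    intro l
    induction l with
    | zero => intro _; simp
    | succ l ih =>
      intro hl
      have h1 := ih (by omega)
      rw [Finset.sum_range_succ, Finset.sum_range_succ (fun i => (x i - u i) / x i), add_div]
      gcongr
      refine le_trans ?_ h1
      have h2 : ∑ i ∈ Finset.range (l + 1), (x i - u i) ≤ 0 := by
        rw [Finset.sum_sub_distrib]; linarith [hD (l + 1) hl]
      have h3 := hx (l + 1) hl
      have h4 := hx l (by omega)
      have h5 := hanti l hl
      rw [div_le_div_iff₀ h3 h4]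
      nlinarith
  have key : ∑ i ∈ Finset.range n, (u i / x i - 1) ≤ 0 := by
    rcases n with _ | n
    · simp
    · have h1 := abel n (by omega)
      have h2 : 0 ≤ (∑ i ∈ Finset.range (n + 1), (x i - u i)) / x n := by
        apply div_nonneg _ (hx n (by omega)).le
        rw [Finset.sum_sub_distrib]; linarith
      have h3 : ∑ i ∈ Finset.range (n + 1), (u i / x i - 1)
          = - ∑ i ∈ Finset.range (n + 1), (x i - u i) / x i := by
        rw [← Finset.sum_neg_distrib]
        refine Finset.sum_congr rfl fun i hi => ?_
        have := hx i (Finset.mem_range.1 hi)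
        field_simp
        ring
      linarith
  calc ∏ i ∈ Finset.range n, u i
      ≤ ∏ i ∈ Finset.range n, (x i * Real.exp (u i / x i - 1)) := by
        refine Finset.prod_le_prod (fun i hi => hu i (Finset.mem_range.1 hi)) fun i hi => ?_
        have h := hx i (Finset.mem_range.1 hi)
        calc u i = x i * (u i / x i - 1 + 1) := by field_simp; ring
          _ ≤ _ := by gcongr; exact Real.add_one_le_exp _
    _ = (∏ i ∈ Finset.range n, x i) * Real.exp (∑ i ∈ Finset.range n, (u i / x i - 1)) := by
        rw [Finset.prod_mul_distrib, Real.exp_sum]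
    _ ≤ (∏ i ∈ Finset.range n, x i) * 1 := by
        refine mul_le_mul_of_nonneg_left ?_
          (Finset.prod_nonneg fun i hi => (hx i (Finset.mem_range.1 hi)).le)
        exact Real.exp_le_one_iff.2 key
    _ = _ := mul_one _

/-- A nonincreasing sequence satisfying the product-sum inequalities has its partial sums bounded
by those of the reciprocals of the Sylvester sequence. -/
theorem sum_range_le_of_prod_le {d : ℕ} {a : ℕ → ℝ} (hanti : ∀ i, i + 1 < d → a (i + 1) ≤ a i)
    (hprod : ∀ j ≤ d, ∏ i ∈ Finset.range j, a i ≤ 1 - ∑ i ∈ Finset.range j, a i) (j : ℕ)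
    (hj : j ≤ d) :
    ∑ i ∈ Finset.range j, a i ≤ 1 - 1 / sylvesterProd j := by
  induction j using Nat.strong_induction_on with
  | _ j ih =>
    by_contra! hlt
    rcases j with _ | j
    · simp [sylvesterProd_zero] at hlt
    -- At the first violation the last term exceeds 1/s_{j+1}, so by monotonicity all terms are
    -- positive. Majorization then gives ∏ a_i ≥ 1/P_{j+1} > 1 - ∑ a_i, against `hprod`.
    have hlast : 0 < a j := by
      have h1 := ih j (by omega) (by omega)
      have h2 := sum_inv_sylvester (j + 1)
      have h3 := sum_inv_sylvester j
      rw [Finset.sum_range_succ] at h2 hlt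
      have h4 : (0 : ℝ) < 1 / sylvester (j + 1) := one_div_pos.2 (sylvester_cast_pos j)
      linarith
    have hpos : ∀ k ≤ j, 0 < a (j - k) := by
      intro k
      induction k with
      | zero => intro _; simpa using hlast
      | succ k ihk =>
        intro hk
        have h := hanti (j - (k + 1)) (by omega)
        rw [show j - (k + 1) + 1 = j - k by omega] at h
        exact (ihk (by omega)).trans_le h
    have h := prod_range_le_prod_range_of_sum_le (n := j + 1) (x := a)
      (u := fun i => (1 : ℝ) / sylvester (i + 1))
      (fun i hi => by simpa [Nat.sub_sub_self (Nat.lt_succ_iff.1 hi)] using hpos (j - i) (by omega))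
      (fun i hi => hanti i (by omega)) (fun i _ => (one_div_pos.2 (sylvester_cast_pos i)).le)
      (fun l hl => by rw [sum_inv_sylvester]; exact ih l hl (by omega))
      (by rw [sum_inv_sylvester]; exact hlt.le)
    rw [prod_inv_sylvester] at h
    have := hprod (j + 1) hj
    linarith

/-- The function (C - t y) y^r is log-concave on [a, b], so its minimum there is attained at an
endpoint. -/
theorem min_le_sub_mul_mul_pow {C t a b m : ℝ} (r : ℕ) (ha : 0 < a) (hab : t * b < C) (ht : 0 ≤ t)
    (h1 : a ≤ m) (h2 : m ≤ b) :
    min ((C - t * a) * a ^ r) ((C - t * b) * b ^ r) ≤ (C - t * m) * m ^ r := by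
  have hlog : ConcaveOn ℝ (Set.Icc a b) fun y => Real.log (C - t * y) + r * Real.log y := by
    refine ConcaveOn.add ?_ ?_
    · have h := strictConcaveOn_log_Ioi.concaveOn.comp_affineMap
        (AffineMap.const ℝ ℝ C - t • AffineMap.id ℝ ℝ : ℝ →ᵃ[ℝ] ℝ)
      refine (h.subset ?_ (convex_Icc a b)).congr ?_
      · intro y hy
        simp only [Set.mem_preimage, Set.mem_Ioi]
        simp
        nlinarith [hy.2]
      · intro y _
        simp
    · have h := (strictConcaveOn_log_Ioi.concaveOn.subset (s := Set.Icc a b)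
        (fun y hy => ha.trans_le hy.1) (convex_Icc a b)).smul (Nat.cast_nonneg (α := ℝ) r)
      simpa using h
  have hb : 0 < b := ha.trans_le (h1.trans h2)
  have hm : 0 < m := ha.trans_le h1
  have h := hlog.min_le_of_mem_Icc (Set.left_mem_Icc.2 (h1.trans h2))
    (Set.right_mem_Icc.2 (h1.trans h2)) ⟨h1, h2⟩
  have pa : 0 < C - t * a := by nlinarith
  have pb : 0 < C - t * b := by nlinarith
  have pm : 0 < C - t * m := by nlinarith
  have e : ∀ y : ℝ, 0 < y → 0 < C - t * y →
      Real.log (C - t * y) + r * Real.log y = Real.log ((C - t * y) * y ^ r) := fun y hy hy' => by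
    rw [Real.log_mul hy'.ne' (by positivity), Real.log_pow]
  rw [e a ha pa, e b hb pb, e m hm pm] at h
  rcases min_le_iff.1 h with h | h
  · exact min_le_iff.2 (Or.inl ((Real.log_le_log_iff (by positivity) (by positivity)).1 h))
  · exact min_le_iff.2 (Or.inr ((Real.log_le_log_iff (by positivity) (by positivity)).1 h))

/-- Locates μ among the decreasing numbers 1/P_N, stopping at D; N becomes the number of Sylvester
terms in the extremal sequence. -/
theorem exists_lt_le_inv_sylvesterProd (D : ℕ) {μ : ℝ} (hμ : μ ≤ 1) :
    ∃ N ≤ D, μ ≤ 1 / sylvesterProd N ∧ (N = D ∨ 1 / (sylvesterProd (N + 1) : ℝ) < μ) := by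
  induction D with
  | zero => exact ⟨0, le_rfl, by simpa [sylvesterProd_zero] using hμ, Or.inl rfl⟩
  | succ D ih =>
    obtain ⟨N, hN, h1, h2⟩ := ih
    rcases h2 with rfl | h2
    · by_cases h : μ ≤ 1 / sylvesterProd (N + 1)
      · exact ⟨N + 1, le_rfl, h, Or.inl rfl⟩
      · exact ⟨N, by omega, h1, Or.inr (not_le.1 h)⟩
    · exact ⟨N, by omega, h1, Or.inr h2⟩

/-- With K = N + r + 2, m lies between 1/(K P_{N+1}) and 1/(K P_N), and by log-concavity only these
endpoints matter. They follow from `sylvesterProd_pow_le` at (N, r) and (N + 1, r - 1). For r = 0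
the expression decreases in m, so the upper endpoint suffices. -/
theorem inv_le_sub_mul_mul_pow (N r : ℕ) {m : ℝ}
    (h1 : (N + r + 2 : ℝ) * m ≤ 1 / sylvesterProd N)
    (h2 : r = 0 ∨ 1 / (sylvesterProd (N + 1) : ℝ) < (N + r + 2 : ℝ) * m) :
    1 / ((N + r + 2 : ℝ) * (sylvesterProd (N + r) : ℝ) ^ 2)
      ≤ 1 / sylvesterProd N * ((1 / sylvesterProd N - (N + r + 1) * m) * m ^ r) := by
  have hP := sylvesterProd_pos N
  have hP' := sylvesterProd_pos (N + r)
  have hP1 := sylvesterProd_pos (N + 1)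
  set K : ℝ := N + r + 2 with hK
  have hK0 : 0 < K := by positivity
  have hbase : 1 / (K * (sylvesterProd (N + r) : ℝ) ^ 2) ≤ 1 / sylvesterProd N *
      ((1 / sylvesterProd N - (N + r + 1) * (1 / (K * sylvesterProd N)))
        * (1 / (K * sylvesterProd N)) ^ r) := by
    have h := sylvesterProd_pow_le N r
    have h' : (sylvesterProd N : ℝ) ^ (r + 2) * K ^ r ≤ (sylvesterProd (N + r) : ℝ) ^ 2 := by
      rw [hK]; exact_mod_cast h
    have e : (1 : ℝ) / sylvesterProd N *
      ((1 / sylvesterProd N - (N + r + 1) * (1 / (K * sylvesterProd N)))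
        * (1 / (K * sylvesterProd N)) ^ r) = 1 / (K * ((sylvesterProd N : ℝ) ^ (r + 2) * K ^ r)) := by
      have : (N + r + 1 : ℝ) = K - 1 := by rw [hK]; ring
      rw [this, div_pow, one_pow, mul_pow]
      field_simp
      ring
    rw [e]
    gcongr
  rcases Nat.eq_zero_or_pos r with rfl | hr
  · refine hbase.trans ?_
    have : m ≤ 1 / (K * sylvesterProd N) := by
      rw [le_div_iff₀ (by positivity)] at h1 ⊢
      linarith
    simp only [pow_zero, mul_one]
    gcongr
  · obtain ⟨q, rfl⟩ : ∃ q, r = q + 1 := ⟨r - 1, by omega⟩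
    replace h2 := h2.resolve_left (by omega)
    have hb : m ≤ 1 / (K * sylvesterProd N) := by
      rw [le_div_iff₀ (by positivity)] at h1 ⊢
      linarith
    have ha : 1 / (K * sylvesterProd (N + 1)) ≤ m := by
      rw [div_lt_iff₀ hP1] at h2
      rw [div_le_iff₀ (by positivity)]
      linarith
    have hmin := min_le_sub_mul_mul_pow (C := 1 / sylvesterProd N)
      (t := (N + (q + 1 : ℕ) + 1 : ℝ)) (q + 1)
      (by positivity : 0 < 1 / (K * sylvesterProd (N + 1)))
      (by
        rw [mul_one_div, div_lt_div_iff₀ (by positivity) hP, hK]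
        nlinarith) (by positivity) ha hb
    have hother : 1 / (K * (sylvesterProd (N + (q + 1)) : ℝ) ^ 2) ≤ 1 / sylvesterProd N *
      ((1 / sylvesterProd N - (N + (q + 1 : ℕ) + 1) * (1 / (K * sylvesterProd (N + 1))))
        * (1 / (K * sylvesterProd (N + 1))) ^ (q + 1)) := by
      have h := sylvesterProd_pow_le (N + 1) q
      rw [show N + 1 + q = N + (q + 1) by ring, show N + (q + 1) + 2 = N + q + 3 by ring] at h
      have h' : (sylvesterProd (N + 1) : ℝ) ^ (q + 2) * K ^ q
          ≤ (sylvesterProd (N + (q + 1)) : ℝ) ^ 2 := by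
        have : K = ((N + q + 3 : ℕ) : ℝ) := by rw [hK]; push_cast; ring
        rw [this]; exact_mod_cast h
      have hS : (sylvesterProd (N + 1) : ℝ) = sylvesterProd N * (1 + sylvesterProd N) := by
        exact_mod_cast sylvesterProd_succ N
      have hstep : 1 / (sylvesterProd (N + 1) : ℝ) ≤ 1 / sylvesterProd N *
          (1 / sylvesterProd N - (N + (q + 1 : ℕ) + 1) * (1 / (K * sylvesterProd (N + 1)))) := by
        have e1 : (N + (q + 1 : ℕ) + 1) * (1 / (K * sylvesterProd (N + 1)))
            ≤ 1 / (sylvesterProd (N + 1) : ℝ) := by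
          rw [mul_one_div, div_le_div_iff₀ (by positivity) hP1, hK]
          nlinarith
        have e2 : 1 / (sylvesterProd (N + 1) : ℝ) = 1 / sylvesterProd N *
            (1 / sylvesterProd N - 1 / (sylvesterProd (N + 1) : ℝ)) := by
          rw [hS]; field_simp; ring
        rw [e2]
        gcongr
      calc 1 / (K * (sylvesterProd (N + (q + 1)) : ℝ) ^ 2)
          ≤ 1 / (K * ((sylvesterProd (N + 1) : ℝ) ^ (q + 2) * K ^ q)) := by gcongr
        _ = 1 / (sylvesterProd (N + 1) : ℝ) * (1 / (K * sylvesterProd (N + 1))) ^ (q + 1) := by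
            rw [div_pow, one_pow, mul_pow]
            field_simp
            ring
        _ ≤ _ := by rw [← mul_assoc]; gcongr
    calc _ ≤ 1 / (sylvesterProd N : ℝ) * _ :=
          (le_min hbase hother).trans_eq (mul_min_of_nonneg _ _ (by positivity)).symm
      _ ≤ _ := by
          rw [min_comm]
          gcongr

/-- The lower bound for the product of the barycentric coordinates. -/
theorem inv_le_prod_add {D : ℕ} {a : ℕ → ℝ} {m : ℝ} (hm : 0 < m)
    (ha : ∀ i ≤ D, 0 ≤ a i) (hanti : ∀ i < D, a (i + 1) ≤ a i)
    (hprod : ∀ j ≤ D + 1, ∏ i ∈ Finset.range j, a i ≤ 1 - ∑ i ∈ Finset.range j, a i)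
    (hsum : ∑ i ∈ Finset.range (D + 1), a i + (D + 2) * m = 1) :
    1 / ((D + 2 : ℝ) * (sylvesterProd D : ℝ) ^ 2) ≤ ∏ i ∈ Finset.range (D + 1), (a i + m) := by
  have hpre := sum_range_le_of_prod_le (d := D + 1) (fun i hi => hanti i (by omega)) hprod
  have hs0 : 0 ≤ ∑ i ∈ Finset.range (D + 1), a i :=
    Finset.sum_nonneg fun i hi => ha i (by simpa [Nat.lt_succ_iff] using hi)
  obtain ⟨N, hN, h1, h2⟩ := exists_lt_le_inv_sylvesterProd D (μ := (D + 2) * m) (by linarith)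
  obtain ⟨r, rfl⟩ := Nat.exists_eq_add_of_le hN
  push_cast at *
  refine (inv_le_sub_mul_mul_pow N r h1 (h2.imp_left (by omega))).trans ?_
  -- The extremal sequence: its term at N is chosen so that all N + r + 1 terms sum to 1 - m, as the
  -- a_i + m do.
  set u : ℕ → ℝ := fun i => if i < N then 1 / (sylvester (i + 1) : ℝ) + m
    else if i = N then 1 / (sylvesterProd N : ℝ) - (N + r + 1) * m else m with hu
  have hsu1 : ∀ l ≤ N, ∑ i ∈ Finset.range l, u i = 1 - 1 / sylvesterProd l + l * m := by
    intro l hl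
    rw [← sum_inv_sylvester, Finset.sum_congr rfl (fun i hi => if_pos
      ((Finset.mem_range.1 hi).trans_le hl)), Finset.sum_add_distrib]
    simp
  have hsu2 : ∀ l, ∑ i ∈ Finset.range (N + 1 + l), u i
      = 1 - (N + r + 2) * m + (N + 1 + l : ℝ) * m := by
    intro l
    induction l with
    | zero =>
      rw [add_zero, Finset.sum_range_succ, hsu1 N le_rfl]
      simp only [hu, lt_irrefl, if_false, if_true]
      push_cast
      ring
    | succ l ih =>
      rw [← add_assoc, Finset.sum_range_succ, ih]
      simp only [hu, if_neg (show ¬ N + 1 + l < N by omega),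
        if_neg (show ¬ N + 1 + l = N by omega)]
      push_cast
      ring
  have hCN : 0 ≤ 1 / (sylvesterProd N : ℝ) - (N + r + 1) * m := by nlinarith
  have hsa : ∀ l, ∑ i ∈ Finset.range l, (a i + m) = ∑ i ∈ Finset.range l, a i + l * m := by
    intro l
    rw [Finset.sum_add_distrib]
    simp
  have hmaj := prod_range_le_prod_range_of_sum_le (n := N + r + 1) (x := fun i => a i + m) (u := u)
    (fun i hi => add_pos_of_nonneg_of_pos (ha i (by omega)) hm)
    (fun i hi => by simpa using hanti i (by omega))
    (fun i _ => by
      have := sylvester_cast_pos i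
      simp only [hu]
      split_ifs
      · positivity
      · exact hCN
      · exact hm.le)
    (fun l hl => by
      rw [hsa]
      rcases le_or_gt l N with h | h
      · rw [hsu1 l h]
        linarith [hpre l (by omega)]
      · obtain ⟨t, rfl⟩ := Nat.exists_eq_add_of_le (Nat.succ_le_of_lt h)
        rw [Nat.succ_eq_add_one, hsu2]
        -- Past index N the comparison needs only a_i ≥ 0: the sum of all the a_i is exactly 1 - (N
        -- + r + 2) m.
        have hmono : ∑ i ∈ Finset.range (N + 1 + t), a i ≤ ∑ i ∈ Finset.range (N + r + 1), a i :=
          Finset.sum_le_sum_of_subset_of_nonneg (Finset.range_subset_range.2 hl.le)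
            fun i hi _ => ha i (by have := Finset.mem_range.1 hi; omega)
        push_cast
        linarith)
    (by
      rw [hsa, show N + r + 1 = N + 1 + r by ring, hsu2, show N + 1 + r = N + r + 1 by ring]
      push_cast
      linarith)
  refine le_trans ?_ hmaj
  have e1 : u N = 1 / (sylvesterProd N : ℝ) - (N + r + 1) * m := by simp [hu]
  have e2 : ∏ i ∈ Finset.range r, u (N + 1 + i) = m ^ r := by
    rw [Finset.prod_congr rfl (g := fun _ => m), Finset.prod_const, Finset.card_range]
    intro i _
    simp only [hu, if_neg (show ¬ N + 1 + i < N by omega), if_neg (show ¬ N + 1 + i = N by omega)]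
  rw [show N + r + 1 = N + 1 + r by ring, Finset.prod_range_add, Finset.prod_range_succ, mul_assoc,
    e1, e2]
  refine mul_le_mul_of_nonneg_right ?_ (mul_nonneg hCN (by positivity))
  rw [← prod_inv_sylvester]
  refine Finset.prod_le_prod (fun i _ => (one_div_pos.2 (sylvester_cast_pos i)).le) fun i hi => ?_
  simp only [hu, if_pos (Finset.mem_range.1 hi)]
  linarith

/-! ### Blichfeldt's theorem with multiplicities -/

open scoped Pointwise in
/-- **Blichfeldt's theorem**: a measurable set of volume more than `k` has a translate containing
`k + 1` integer points. -/
theorem exists_injective_add_int_mem {ι : Type*} [Fintype ι] {E : Set (ι → ℝ)}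
    (hE : MeasurableSet E) {k : ℕ} (hk : (k : ENNReal) < volume E) :
    ∃ (x : ι → ℝ) (z : Fin (k + 1) → ι → ℤ), Function.Injective z ∧
      ∀ j, (fun i => x i + z j i) ∈ E := by
  classical
  set b := Pi.basisFun ℝ ι with hb
  set L := (Submodule.span ℤ (Set.range b)).toAddSubgroup with hL
  have hF := ZSpan.isAddFundamentalDomain' b volume
  have hFv : volume (ZSpan.fundamentalDomain b) = 1 := by
    rw [hb, ZSpan.fundamentalDomain_pi_basisFun]
    simp [volume_pi_pi]
  have hint : ∀ g : L, ∃ z : ι → ℤ, ∀ i, (g : ι → ℝ) i = z i := by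
    intro g
    have h := (Module.Basis.mem_span_iff_repr_mem ℤ b (g : ι → ℝ)).1 g.2
    choose z hz using h
    exact ⟨z, fun i => by simpa [hb] using (hz i).symm⟩
  choose Z hZ using hint
  have hZinj : Function.Injective Z := fun g g' h => Subtype.ext <| by
    funext i
    rw [hZ, hZ, h]
  have : Countable L := hZinj.countable
  by_contra! hcon
  refine hk.not_ge ?_
  rw [hF.measure_eq_tsum E]
  have hme : ∀ g : L, MeasurableSet (g +ᵥ E) := fun g => hE.const_vadd g
  -- The volume of E is the integral over a unit cell of the number of lattice translates of E
  -- covering a point; by assumption at most k do.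
  calc ∑' g : L, volume ((g +ᵥ E) ∩ ZSpan.fundamentalDomain b)
      = ∑' g : L, ∫⁻ x in ZSpan.fundamentalDomain b, (g +ᵥ E).indicator 1 x := by
        congr 1; ext g
        rw [lintegral_indicator_one (hme g), Measure.restrict_apply (hme g)]
    _ = ∫⁻ x in ZSpan.fundamentalDomain b, ∑' g : L, (g +ᵥ E).indicator 1 x :=
        (lintegral_tsum fun g => ((measurable_one).indicator (hme g)).aemeasurable).symm
    _ ≤ ∫⁻ x in ZSpan.fundamentalDomain b, k := by
        refine lintegral_mono fun x => ?_
        rw [ENNReal.tsum_eq_iSup_sum]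
        refine iSup_le fun s => ?_
        have hcard : ∑ g ∈ s, (g +ᵥ E).indicator (1 : (ι → ℝ) → ENNReal) x
            = ((s.filter fun g => x ∈ g +ᵥ E).card : ENNReal) := by
          simp [Set.indicator_apply]
        rw [hcard]
        norm_cast
        by_contra! hlt
        obtain ⟨t, hts, htc⟩ := Finset.exists_subset_card_eq (Nat.succ_le_of_lt hlt)
        let e := t.equivFinOfCardEq htc
        obtain ⟨j, hj⟩ := hcon x (fun j => - Z (e.symm j)) (by
          intro j j' h
          have h' : Z (e.symm j) = Z (e.symm j') := neg_injective h
          exact e.symm.injective (Subtype.ext (hZinj h')))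
        have hmem := (Finset.mem_filter.1 (hts (e.symm j).2)).2
        rw [Set.mem_vadd_set_iff_neg_vadd_mem] at hmem
        apply hj
        convert hmem using 1
        funext i
        simp [← hZ, AddSubgroup.vadd_def, add_comm]
    _ = k := by simp [hFv]

/-- Given a nonsingular linear map and a box whose volume exceeds `k` times its determinant, the box
contains `k + 1` points congruent modulo the image of the integer lattice. -/
theorem exists_injective_mulVec_mem_box {ι : Type*} [Fintype ι] [DecidableEq ι] {A : Matrix ι ι ℝ}
    (hA : A.det ≠ 0) {c : ι → ℝ} (hc : ∀ i, 0 ≤ c i) {k : ℕ} (hk : k * |A.det| < ∏ i, c i) :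
    ∃ (p : Fin (k + 1) → ι → ℝ) (z : Fin (k + 1) → ι → ℤ), Function.Injective z ∧
      (∀ j i, 0 ≤ p j i ∧ p j i < c i) ∧
      ∀ j j', A.mulVec (fun i => (z j i : ℝ) - z j' i) = p j - p j' := by
  have hdet : LinearMap.det A.toLin' ≠ 0 := by rwa [LinearMap.det_toLin']
  have hmeas : MeasurableSet (A.toLin' ⁻¹' Set.univ.pi fun i => Set.Ico 0 (c i)) :=
    (LinearMap.continuous_of_finiteDimensional _).measurable
      (MeasurableSet.univ_pi fun i => measurableSet_Ico)
  obtain ⟨x, z, hz, hx⟩ := exists_injective_add_int_mem (k := k) hmeas (by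
    rw [Measure.addHaar_preimage_linearMap _ hdet, LinearMap.det_toLin', Real.volume_pi_Ico,
      ← ENNReal.ofReal_prod_of_nonneg (by simpa using hc),
      ← ENNReal.ofReal_mul (abs_nonneg _), ← ENNReal.ofReal_natCast]
    have h0 : 0 < |A.det| := abs_pos.2 hA
    have hk' : (k : ℝ) < |A.det⁻¹| * ∏ i, (c i - 0) := by
      rw [abs_inv, inv_mul_eq_div, lt_div_iff₀ h0]
      simpa using hk
    exact (ENNReal.ofReal_lt_ofReal_iff ((Nat.cast_nonneg k).trans_lt hk')).2 hk')
  refine ⟨fun j => A.mulVec fun i => x i + z j i, z, hz, fun j i => ?_, fun j j' => ?_⟩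
  · have h := hx j
    simp only [Set.mem_preimage, Matrix.toLin'_apply, Set.mem_univ_pi] at h
    exact h i
  · rw [← Matrix.mulVec_sub]
    congr 1
    funext i
    simp

/-- A Diophantine approximation lemma behind the product-sum inequality. -/
theorem exists_int_abs_lt {ι : Type*} [Fintype ι] {b c : ι → ℝ} (hc : ∀ i, 0 ≤ c i)
    (h0 : 0 < 1 - ∑ i, b i) (h : 1 - ∑ i, b i < ∏ i, c i) :
    ∃ n : ι → ℤ, n ≠ 0 ∧ ∀ i, |((∑ j, n j : ℤ) : ℝ) * b i - n i| < c i := by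
  classical
  -- A n = n - (∑ n_j) b, and the matrix determinant lemma gives det A = 1 - ∑ b_i. Two congruent
  -- points of the half-open box differ by less than c_i in each coordinate.
  set A : Matrix ι ι ℝ := 1 + (Matrix.replicateCol Unit (-b) : Matrix ι Unit ℝ) *
    (Matrix.replicateRow Unit 1 : Matrix Unit ι ℝ) with hA
  have hdet : A.det = 1 - ∑ i, b i := by
    rw [hA, Matrix.det_one_add_replicateCol_mul_replicateRow]
    simp [dotProduct, sub_eq_add_neg]
  obtain ⟨p, z, hz, hp, hAz⟩ := exists_injective_mulVec_mem_box (A := A) (k := 1)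
    (by rw [hdet]; exact h0.ne') hc (by rw [hdet, abs_of_pos h0]; simpa using h)
  refine ⟨z 1 - z 0, sub_ne_zero.2 fun h => by simpa using hz h, fun i => ?_⟩
  have h1 := congrFun (hAz 1 0) i
  rw [hA, Matrix.add_mulVec, Matrix.one_mulVec, ← Matrix.mulVec_mulVec] at h1
  simp only [Pi.add_apply, Matrix.mulVec, dotProduct, Matrix.replicateCol_apply,
    Matrix.replicateRow_apply, Pi.one_apply, Pi.neg_apply, Pi.sub_apply, one_mul,
    Finset.univ_unique, Finset.sum_singleton] at h1
  have h2 : ((∑ j, (z 1 - z 0) j : ℤ) : ℝ) * b i - ((z 1 - z 0) i : ℤ) = p 0 i - p 1 i := by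
    push_cast [Pi.sub_apply]
    linarith
  rw [h2, abs_lt]
  constructor <;> linarith [hp 0 i, hp 1 i]

/-! ### The volume of a simplex -/

/-- The corner simplex of size `s` in `ℝ^n`. -/
def cornerSimplex (n : ℕ) (s : ℝ) : Set (Fin n → ℝ) := {x | (∀ i, 0 ≤ x i) ∧ ∑ i, x i ≤ s}

/-- Slicing at first coordinate x leaves a corner simplex of size s - x, which is why the induction
needs arbitrary s. -/
theorem volume_cornerSimplex (n : ℕ) {s : ℝ} (hs : 0 ≤ s) :
    volume (cornerSimplex n s) = ENNReal.ofReal (s ^ n / n.factorial) := by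
  induction n generalizing s with
  | zero =>
    have : cornerSimplex 0 s = Set.univ := by
      ext x; simp [cornerSimplex, hs]
    rw [this, volume_pi, Measure.pi_univ]
    simp
  | succ n ih =>
    have hmp := volume_preserving_piFinSuccAbove (fun _ : Fin (n + 1) => ℝ) 0
    set T : Set (ℝ × (Fin n → ℝ)) := {y | 0 ≤ y.1 ∧ (∀ i, 0 ≤ y.2 i) ∧
      ∑ i, y.2 i ≤ s - y.1} with hT
    have hTm : MeasurableSet T := by
      refine IsClosed.measurableSet ?_
      simp only [hT, Set.ofPred_and, Set.ofPred_forall]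
      exact (isClosed_le continuous_const continuous_fst).inter
        ((isClosed_iInter fun i => isClosed_le continuous_const (by fun_prop)).inter
          (isClosed_le (by fun_prop) (by fun_prop)))
    have hpre : cornerSimplex (n + 1) s
        = MeasurableEquiv.piFinSuccAbove (fun _ : Fin (n + 1) => ℝ) 0 ⁻¹' T := by
      ext x
      simp only [cornerSimplex, hT, Set.mem_ofPred_eq, Set.mem_preimage, Fin.forall_fin_succ,
        Fin.sum_univ_succ, MeasurableEquiv.piFinSuccAbove_apply, Fin.insertNthEquiv_zero,
        Fin.consEquiv_symm_apply, Fin.tail, le_sub_iff_add_le', and_assoc]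
    rw [hpre, hmp.measure_preimage hTm.nullMeasurableSet, Measure.volume_eq_prod,
      Measure.prod_apply hTm]
    have hsec : ∀ x : ℝ, volume (Prod.mk x ⁻¹' T)
        = (Set.Icc 0 s).indicator (fun x => ENNReal.ofReal ((s - x) ^ n / n.factorial)) x := by
      intro x
      by_cases hx : x ∈ Set.Icc 0 s
      · rw [Set.indicator_of_mem hx, ← ih (sub_nonneg.2 hx.2)]
        congr 1
        ext y
        simp [hT, hx.1, cornerSimplex]
      · rw [Set.indicator_of_notMem hx]
        convert measure_empty (μ := (volume : Measure (Fin n → ℝ)))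
        ext y
        simp only [hT, Set.mem_preimage, Set.mem_ofPred_eq, Set.mem_empty_iff_false,
          iff_false]
        rintro ⟨h1, h2, h3⟩
        exact hx ⟨h1, by linarith [Finset.sum_nonneg fun i (_ : i ∈ Finset.univ) => h2 i]⟩
    simp_rw [hsec]
    rw [lintegral_indicator measurableSet_Icc, ← ofReal_integral_eq_lintegral_ofReal
      (Continuous.integrableOn_Icc (by fun_prop))
      ((ae_restrict_iff' measurableSet_Icc).2 (Filter.Eventually.of_forall fun x hx => by
        have := sub_nonneg.2 hx.2
        simp only [Pi.zero_apply]
        positivity)),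
      integral_Icc_eq_integral_Ioc, ← intervalIntegral.integral_of_le hs]
    congr 1
    have h1 := intervalIntegral.integral_comp_sub_left (a := 0) (b := s)
      (fun x : ℝ => x ^ n / n.factorial) s
    rw [h1, intervalIntegral.integral_div, sub_self, sub_zero, integral_pow, Nat.factorial_succ]
    push_cast
    field_simp
    simp

/-! ### Simplices and barycentric coordinates -/

/-- The matrix whose columns are the edge vectors of a simplex at its last vertex. -/
def edgeMatrix {d : ℕ} (v : Fin (d + 1) → Fin d → ℝ) : Matrix (Fin d) (Fin d) ℝ :=
  Matrix.of fun i j => v j.castSucc i - v (Fin.last d) i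

theorem sum_smul_eq_add_edgeMatrix_mulVec {d : ℕ} (v : Fin (d + 1) → Fin d → ℝ)
    {w : Fin (d + 1) → ℝ} (hw : ∑ i, w i = 1) :
    ∑ i, w i • v i = v (Fin.last d) + (edgeMatrix v).mulVec (fun j => w j.castSucc) := by
  rw [Fin.sum_univ_castSucc] at hw ⊢
  ext i
  simp only [Pi.add_apply, Finset.sum_apply, Pi.smul_apply, smul_eq_mul, edgeMatrix,
    Matrix.mulVec, dotProduct, Matrix.of_apply, sub_mul, Finset.sum_sub_distrib]
  rw [← Finset.mul_sum, show w (Fin.last d) = 1 - ∑ j : Fin d, w j.castSucc by linarith]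
  simp only [mul_comm (w _)]
  ring

theorem AffineBasis.coord_sum_smul {ι V : Type*} [Fintype ι] [AddCommGroup V] [Module ℝ V]
    (b : AffineBasis ι ℝ V) {w : ι → ℝ} (hw : ∑ i, w i = 1) (i : ι) :
    b.coord i (∑ j, w j • b j) = w i := by
  rw [← b.coord_apply_combination_of_mem (Finset.mem_univ i) hw,
    Finset.univ.affineCombination_eq_linear_combination _ _ hw]

theorem AffineBasis.eq_add_edgeMatrix_mulVec {d : ℕ} (b : AffineBasis (Fin (d + 1)) ℝ (Fin d → ℝ))
    (x : Fin d → ℝ) :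
    x = b (Fin.last d) + (edgeMatrix b).mulVec (fun j => b.coord j.castSucc x) := by
  rw [← sum_smul_eq_add_edgeMatrix_mulVec b (w := fun i => b.coord i x)
    (b.sum_coord_apply_eq_one x), b.linear_combination_coord_eq_self]

theorem AffineBasis.coord_add_edgeMatrix_mulVec {d : ℕ}
    (b : AffineBasis (Fin (d + 1)) ℝ (Fin d → ℝ)) (t : Fin d → ℝ) :
    (∀ j : Fin d, b.coord j.castSucc (b (Fin.last d) + (edgeMatrix b).mulVec t) = t j) ∧
      b.coord (Fin.last d) (b (Fin.last d) + (edgeMatrix b).mulVec t) = 1 - ∑ j, t j := by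
  set w : Fin (d + 1) → ℝ := Fin.snoc t (1 - ∑ j, t j) with hw
  have hw1 : ∑ i, w i = 1 := by simp [hw, Fin.sum_univ_castSucc]
  have hwt : (fun j : Fin d => w j.castSucc) = t := by ext j; simp [hw]
  have h := sum_smul_eq_add_edgeMatrix_mulVec b hw1
  rw [hwt] at h
  rw [← h]
  refine ⟨fun j => ?_, ?_⟩
  · rw [b.coord_sum_smul hw1]
    simp [hw]
  · rw [b.coord_sum_smul hw1]
    simp [hw]

theorem AffineBasis.det_edgeMatrix_ne_zero {d : ℕ}
    (b : AffineBasis (Fin (d + 1)) ℝ (Fin d → ℝ)) : (edgeMatrix b).det ≠ 0 := by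
  intro h
  obtain ⟨t, ht, h0⟩ := Matrix.exists_mulVec_eq_zero_iff.2 h
  refine ht (funext fun j => ?_)
  rw [← (b.coord_add_edgeMatrix_mulVec t).1 j, h0]
  simp [b.coord_apply_ne (Fin.castSucc_lt_last j).ne]

theorem AffineBasis.volume_real_convexHull {d : ℕ}
    (b : AffineBasis (Fin (d + 1)) ℝ (Fin d → ℝ)) :
    volume.real (convexHull ℝ (Set.range b)) = |(edgeMatrix b).det| / d.factorial := by
  have himg : convexHull ℝ (Set.range b)
      = (fun x => b (Fin.last d) + x) '' ((edgeMatrix b).toLin' '' cornerSimplex d 1) := by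
    rw [b.convexHull_eq_nonneg_coord]
    ext x
    simp only [Set.mem_ofPred_eq, Set.image_image, Set.mem_image, cornerSimplex,
      Matrix.toLin'_apply]
    constructor
    · intro hx
      refine ⟨fun j => b.coord j.castSucc x, ⟨fun j => hx _, ?_⟩,
        (b.eq_add_edgeMatrix_mulVec x).symm⟩
      have h := b.sum_coord_apply_eq_one x
      rw [Fin.sum_univ_castSucc] at h
      linarith [hx (Fin.last d)]
    · rintro ⟨t, ⟨h1, h2⟩, rfl⟩ i
      obtain ⟨h3, h4⟩ := b.coord_add_edgeMatrix_mulVec t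
      induction i using Fin.lastCases with
      | last => rw [h4]; linarith
      | cast j => rw [h3]; exact h1 j
  rw [measureReal_def, himg, Set.image_add_left, measure_preimage_add,
    Measure.addHaar_image_linearMap, volume_cornerSimplex d zero_le_one, LinearMap.det_toLin',
    ENNReal.toReal_mul, ENNReal.toReal_ofReal (abs_nonneg _),
    ENNReal.toReal_ofReal (by positivity), one_pow, mul_one_div]

/-! ### The volume bound -/

/-- The lattice `ℤ^d` as an additive subgroup of `ℝ^d`. -/
def latticeSubgroup (d : ℕ) : AddSubgroup (Fin d → ℝ) where
  carrier := latticePoints d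
  zero_mem' := ⟨0, by ext; simp⟩
  add_mem' := by
    rintro _ _ ⟨y, rfl⟩ ⟨z, rfl⟩
    exact ⟨y + z, by ext; simp⟩
  neg_mem' := by
    rintro _ ⟨y, rfl⟩
    exact ⟨-y, by ext; simp⟩

/-- The product-sum inequality: if the interior lattice point `x` maximizes the smallest barycentric
coordinate, then the barycentric coordinates of `x`, diminished by the smallest one, have products
bounded by complementary sums. -/
theorem AffineBasis.prod_coord_sub_le {ι V : Type*} [Fintype ι] [AddCommGroup V] [Module ℝ V]
    (b : AffineBasis ι ℝ V) {L : AddSubgroup V} (hb : ∀ i, b i ∈ L) {x : V} (hx : x ∈ L)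
    (hpos : ∀ i, 0 < b.coord i x) {i₀ : ι} (hmin : ∀ i, b.coord i₀ x ≤ b.coord i x)
    (hmax : ∀ y ∈ L, (∀ i, 0 < b.coord i y) → ∃ i, b.coord i y ≤ b.coord i₀ x)
    {J : Finset ι} (hJ : i₀ ∉ J) :
    ∏ i ∈ J, (b.coord i x - b.coord i₀ x) ≤ 1 - ∑ i ∈ J, b.coord i x := by
  classical
  by_contra! hlt
  have hsum := b.sum_coord_apply_eq_one x
  have hle1 : ∀ i, b.coord i x ≤ 1 := fun i => by
    rw [← hsum]
    exact Finset.single_le_sum (fun i _ => (hpos i).le) (Finset.mem_univ i)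
  have h0 : 0 < 1 - ∑ i ∈ J, b.coord i x := by
    rw [← hsum, sub_pos]
    exact Finset.sum_lt_sum_of_subset (Finset.subset_univ J) (Finset.mem_univ i₀) hJ (hpos i₀)
      fun i _ _ => (hpos i).le
  rw [← Finset.sum_coe_sort, ← Finset.prod_coe_sort] at hlt
  rw [← Finset.sum_coe_sort] at h0
  obtain ⟨n, hn0, hn⟩ := exists_int_abs_lt (b := fun i : J => b.coord i x)
    (c := fun i : J => b.coord i x - b.coord i₀ x) (fun i => sub_nonneg.2 (hmin i)) h0 hlt
  -- The approximation is symmetric under n ↦ -n, so the total may be taken nonnegative. A zero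
  -- total would force every |n_i| < 1, hence n = 0.
  have key : ∀ n : J → ℤ, n ≠ 0 → (∀ i : J, |((∑ j, n j : ℤ) : ℝ) * b.coord i x - n i|
      < b.coord i x - b.coord i₀ x) → 0 ≤ ∑ j, n j → False := by
    intro n hn0 hn hnn
    obtain ⟨h, hh⟩ : ∃ h : ℤ, h = ∑ j, n j := ⟨_, rfl⟩
    rw [← hh] at hn hnn
    have hh1 : 1 ≤ h := by
      by_contra! hcon
      obtain rfl : h = 0 := by omega
      refine hn0 (funext fun i => ?_)
      have h1 := hn i
      rw [Int.cast_zero, zero_mul, zero_sub, abs_neg] at h1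
      have h2 : |(n i : ℝ)| < 1 := by linarith [hle1 i, hpos i₀]
      exact Int.abs_lt_one_iff.1 (by exact_mod_cast h2)
    set N : ι → ℤ := fun i => if hi : i ∈ J then n ⟨i, hi⟩ else 0 with hN
    have hNJ : ∀ i : J, N i = n i := fun i => by simp [hN]
    have hNsum : ∑ i, N i = h := by
      rw [hh, ← Finset.sum_subset (Finset.subset_univ J) (fun i _ hi => by simp [hN, hi]),
        ← Finset.sum_coe_sort]
      exact Finset.sum_congr rfl fun i _ => hNJ i
    have hNsum' : ∑ i, (N i : ℝ) = h := by exact_mod_cast hNsum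
    -- Barycentric coordinates of the lattice point (1 + h) x - ∑ N_i b_i. On J, h β_i - n_i > -(β_i
    -- - m) gives w_i > m; off J, w_i = (1 + h) β_i ≥ 2m.
    set w : ι → ℝ := fun i => (1 + h) * b.coord i x - N i with hw
    have hw1 : ∑ i, w i = 1 := by
      rw [hw, Finset.sum_sub_distrib, ← Finset.mul_sum, hsum, hNsum']
      ring
    have hhr : (1 : ℝ) ≤ h := by exact_mod_cast hh1
    have hwlt : ∀ i, b.coord i₀ x < w i := by
      intro i
      by_cases hi : i ∈ J
      · have h1 := (abs_lt.1 (hn ⟨i, hi⟩)).1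
        rw [← hNJ] at h1
        simp only [hw]
        linarith
      · simp only [hw, hN, dif_neg hi, Int.cast_zero]
        nlinarith [hmin i, hpos i, hpos i₀]
    have hy : ∑ i, w i • b i ∈ L := by
      have : ∑ i, w i • b i = (1 + h) • x - ∑ i, N i • b i := by
        conv_rhs => rw [← b.linear_combination_coord_eq_self x]
        simp only [hw, sub_smul, Finset.sum_sub_distrib, Finset.smul_sum, mul_smul]
        congr 1
        · refine Finset.sum_congr rfl fun i _ => ?_
          rw [← Int.cast_smul_eq_zsmul ℝ]
          push_cast
          rfl
        · exact Finset.sum_congr rfl fun i _ => Int.cast_smul_eq_zsmul ℝ _ _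
      rw [this]
      exact L.sub_mem (L.zsmul_mem hx _) (L.sum_mem fun i _ => L.zsmul_mem (hb i) _)
    obtain ⟨i, hi⟩ := hmax _ hy fun i => by
      rw [b.coord_sum_smul hw1]
      exact (hpos i₀).trans (hwlt i)
    rw [b.coord_sum_smul hw1] at hi
    exact (hwlt i).not_ge hi
  rcases le_total 0 (∑ j, n j) with h | h
  · exact key n hn0 hn h
  · refine key (-n) (neg_ne_zero.2 hn0) (fun i => ?_) (by simpa using h)
    have := hn i
    rw [← abs_neg] at this
    convert this using 2
    simp
    ring

/-- The normalized volume of a simplex with at most `k` interior lattice points is controlled by the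
barycentric coordinates of any interior lattice point. -/
theorem AffineBasis.abs_det_edgeMatrix_mul_prod_coord_le {d k : ℕ}
    (b : AffineBasis (Fin (d + 1)) ℝ (Fin d → ℝ))
    (hk : (interior (convexHull ℝ (Set.range b)) ∩ latticePoints d).encard ≤ k)
    {x : Fin d → ℝ} (hx : x ∈ latticePoints d) (hpos : ∀ i, 0 < b.coord i x) :
    |(edgeMatrix b).det| * ∏ j : Fin d, b.coord j.castSucc x ≤ k := by
  by_contra! hlt
  have hdet := b.det_edgeMatrix_ne_zero
  obtain ⟨p, z, hz, hp, hpz⟩ := exists_injective_mulVec_mem_box (A := (edgeMatrix b)⁻¹)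
    (c := fun j => b.coord j.castSucc x) (k := k)
    (by rw [Matrix.det_nonsing_inv]; simpa using hdet) (fun j => (hpos _).le) (by
      rw [Matrix.det_nonsing_inv, Ring.inverse_eq_inv', abs_inv, ← div_eq_mul_inv,
        div_lt_iff₀ (abs_pos.2 hdet), mul_comm]
      exact hlt)
  -- Taking differences from the point with the largest coordinate sum keeps the last barycentric
  -- coordinate from decreasing; the others stay positive because p j₀ i is less than the
  -- corresponding coordinate of x.
  obtain ⟨j₀, hj₀⟩ := Finite.exists_max fun j => ∑ i, p j i
  set y : Fin (k + 1) → Fin d → ℝ := fun j => x + fun i => (z j i : ℝ) - z j₀ i with hy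
  have hyinj : Function.Injective y := by
    intro j j' h
    refine hz (funext fun i => ?_)
    have := congrFun h i
    simp only [hy, Pi.add_apply] at this
    exact_mod_cast (by linarith : (z j i : ℝ) = z j' i)
  have hmem : ∀ j, y j ∈ interior (convexHull ℝ (Set.range b)) ∩ latticePoints d := by
    intro j
    refine ⟨?_, (latticeSubgroup d).add_mem hx ⟨z j - z j₀, by ext; simp⟩⟩
    have hyj : y j = b (Fin.last d)
        + (edgeMatrix b).mulVec ((fun i => b.coord i.castSucc x) + (p j - p j₀)) := by
      rw [Matrix.mulVec_add, ← hpz, Matrix.mulVec_mulVec, Matrix.mul_nonsing_inv _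
        (isUnit_iff_ne_zero.2 hdet), Matrix.one_mulVec, ← add_assoc,
        ← b.eq_add_edgeMatrix_mulVec x]
    obtain ⟨h1, h2⟩ := b.coord_add_edgeMatrix_mulVec
      ((fun i => b.coord i.castSucc x) + (p j - p j₀))
    rw [← hyj] at h1 h2
    rw [b.interior_convexHull]
    intro i
    induction i using Fin.lastCases with
    | last =>
      rw [h2]
      have h3 := b.sum_coord_apply_eq_one x
      rw [Fin.sum_univ_castSucc] at h3
      have h4 := hj₀ j
      simp only [Pi.add_apply, Pi.sub_apply, Finset.sum_add_distrib, Finset.sum_sub_distrib]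
      linarith [hpos (Fin.last d)]
    | cast i =>
      rw [h1]
      simp only [Pi.add_apply, Pi.sub_apply]
      linarith [hp j i, hp j₀ i]
  have hcard := (Set.encard_le_encard (Set.range_subset_iff.2 hmem)).trans hk
  rw [← Set.image_univ, hyinj.encard_image, Set.encard_univ, ENat.card_eq_coe_fintype_card,
    Fintype.card_fin] at hcard
  exact absurd (by exact_mod_cast hcard) (Nat.not_succ_le_self k)

theorem AffineBasis.inv_le_prod_coord {D : ℕ} (b : AffineBasis (Fin (D + 2)) ℝ (Fin (D + 1) → ℝ))
    (hb : ∀ i, b i ∈ latticePoints (D + 1)) {x : Fin (D + 1) → ℝ} (hx : x ∈ latticePoints (D + 1))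
    (hpos : ∀ i, 0 < b.coord i x) (hanti : Antitone fun i => b.coord i x)
    (hmax : ∀ y ∈ latticePoints (D + 1), (∀ i, 0 < b.coord i y) →
      ∃ i, b.coord i y ≤ b.coord (Fin.last (D + 1)) x) :
    1 / ((D + 2 : ℝ) * (sylvesterProd D : ℝ) ^ 2)
      ≤ ∏ j : Fin (D + 1), b.coord j.castSucc x := by
  set m := b.coord (Fin.last (D + 1)) x with hm
  set a : ℕ → ℝ := fun i => if h : i < D + 2 then b.coord ⟨i, h⟩ x - m else 0 with ha
  have haval : ∀ i (h : i < D + 2), a i = b.coord ⟨i, h⟩ x - m := fun i h => dif_pos h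
  have hmin : ∀ i, m ≤ b.coord i x := fun i => hanti (Fin.le_last i)
  have hsum := b.sum_coord_apply_eq_one x
  rw [Fin.sum_univ_castSucc] at hsum
  have hsuma : ∑ i ∈ Finset.range (D + 1), a i
      = ∑ j : Fin (D + 1), b.coord j.castSucc x - (D + 1) * m := by
    have e : ∀ j : Fin (D + 1), a j = b.coord j.castSucc x - m := fun j => haval j (by omega)
    simp only [Finset.sum_range, e, Finset.sum_sub_distrib]
    simp
  have h := inv_le_prod_add (D := D) (a := a) (hpos (Fin.last (D + 1)))
    (fun i hi => by rw [haval i (by omega)]; exact sub_nonneg.2 (hmin _))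
    (fun i hi => by
      rw [haval i (by omega), haval (i + 1) (by omega)]
      exact sub_le_sub_right (hanti (by simp)) _)
    (fun j hj => by
      have hle : j ≤ D + 2 := by omega
      have h := b.prod_coord_sub_le (L := latticeSubgroup (D + 1)) hb hx hpos hmin hmax
        -- The first j ≤ D + 1 indices miss the last one, where the minimum m sits.
        (J := Finset.univ.map (Fin.castLEEmb hle)) (by
          simp only [Finset.mem_map, Finset.mem_univ, true_and, not_exists]
          intro i hi
          have := congrArg Fin.val hi
          simp at this
          omega)
      rw [Finset.prod_map, Finset.sum_map] at h
      rw [Finset.prod_range, Finset.sum_range]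
      have e : ∀ i : Fin j, a i = b.coord (Fin.castLEEmb hle i) x - m :=
        fun i => haval i (by omega)
      simp only [e]
      refine h.trans ?_
      rw [Finset.sum_sub_distrib]
      simp only [Finset.sum_const, Finset.card_univ, Fintype.card_fin, nsmul_eq_mul]
      have : 0 ≤ (j : ℝ) * m := mul_nonneg (Nat.cast_nonneg j) (hpos _).le
      linarith)
    (by rw [hsuma]; linarith)
  refine h.trans_eq ?_
  rw [Finset.prod_range]
  refine Finset.prod_congr rfl fun i _ => ?_
  rw [haval i (by omega), sub_add_cancel]
  rfl

theorem IsLatticeSimplex.exists_affineBasis {d : ℕ} {S : Set (Fin d → ℝ)}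
    (hS : IsLatticeSimplex S) : ∃ b : AffineBasis (Fin (d + 1)) ℝ (Fin d → ℝ),
      (∀ i, b i ∈ latticePoints d) ∧ S = convexHull ℝ (Set.range b) := by
  obtain ⟨T, hT, rfl⟩ := hS
  exact ⟨⟨T.points, T.independent,
    T.independent.affineSpan_eq_top_iff_card_eq_finrank_add_one.2 (by simp)⟩, hT, rfl⟩

theorem volume_real_le_of_mem_latticeSimplices {d k : ℕ} (hd : 1 ≤ d) (hk : 1 ≤ k)
    {S : Set (Fin d → ℝ)} (hS : S ∈ latticeSimplices d k) :
    volume.real S ≤ (k : ℝ) * ((d : ℝ) + 1) * ((sylvester d : ℝ) - 1) ^ 2 / (d.factorial : ℝ) := by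
  obtain ⟨D, rfl⟩ := Nat.exists_eq_add_of_le' hd
  obtain ⟨hS, hcard⟩ := hS
  obtain ⟨b, hb, rfl⟩ := hS.exists_affineBasis
  set I := interior (convexHull ℝ (Set.range b)) ∩ latticePoints (D + 1) with hI
  have hfin : I.Finite := Set.finite_of_encard_eq_coe hcard
  have hne : I.Nonempty := by
    rw [← Set.encard_ne_zero, hcard]
    exact_mod_cast (by omega : k ≠ 0)
  obtain ⟨x, hxI, hxmax⟩ := Set.exists_max_image I
    (fun x => Finset.univ.inf' Finset.univ_nonempty fun i => b.coord i x) hfin hne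
  -- Sorting the negated coordinates puts them in decreasing order, the smallest last.
  set e := Tuple.sort fun i => - b.coord i x with he
  set b' := b.reindex e.symm with hb'
  have hcoord : ∀ i y, b'.coord i y = b.coord (e i) y := fun i y => by simp [hb']
  have hrange : Set.range b' = Set.range b := by
    rw [hb', AffineBasis.coe_reindex]
    exact e.surjective.range_comp b
  have hb'lat : ∀ i, b' i ∈ latticePoints (D + 1) := fun i => by simpa [hb'] using hb (e i)
  have hpos : ∀ i, 0 < b'.coord i x := by
    have := hxI.1
    rw [← hrange, b'.interior_convexHull] at this
    exact this
  have hanti : Antitone fun i => b'.coord i x := by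
    intro i j hij
    have := Tuple.monotone_sort (fun i => - b.coord i x) hij
    simp only [Function.comp_apply, ← he] at this
    simpa only [hcoord] using neg_le_neg_iff.1 this
  have hprod := b'.inv_le_prod_coord hb'lat hxI.2 hpos hanti (by
    intro y hy hypos
    have hyI : y ∈ I := by
      refine ⟨?_, hy⟩
      rw [← hrange, b'.interior_convexHull]
      exact hypos
    obtain ⟨i, -, hi⟩ := Finset.exists_mem_eq_inf' Finset.univ_nonempty fun i => b.coord i y
    refine ⟨e.symm i, ?_⟩
    rw [hcoord, hcoord, Equiv.apply_symm_apply, ← hi]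
    exact (hxmax y hyI).trans (Finset.inf'_le _ (Finset.mem_univ _)))
  have hvol := b'.abs_det_edgeMatrix_mul_prod_coord_le (k := k)
    (by rw [hrange, ← hI, hcard]) hxI.2 hpos
  rw [← hrange, b'.volume_real_convexHull, sylvester_succ]
  gcongr
  have hP := sylvesterProd_pos D
  have h1 : |(edgeMatrix b').det| * (1 / ((D + 2 : ℝ) * (sylvesterProd D : ℝ) ^ 2)) ≤ k :=
    (mul_le_mul_of_nonneg_left hprod (abs_nonneg _)).trans hvol
  rw [mul_one_div, div_le_iff₀ (by positivity)] at h1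
  push_cast
  calc _ ≤ _ := h1
    _ = _ := by ring

/-! ### The maximum exists -/

/-- The edge matrix has integer entries, so d! times the volume is the absolute value of an integer
determinant. With the volume bound this leaves finitely many volumes. -/
theorem exists_nat_volume_real_eq {d k : ℕ} {S : Set (Fin d → ℝ)} (hS : S ∈ latticeSimplices d k) :
    ∃ n : ℕ, volume.real S = n / d.factorial := by
  obtain ⟨b, hb, rfl⟩ := hS.1.exists_affineBasis
  choose z hz using hb
  refine ⟨(Matrix.of fun i j : Fin d => z j.castSucc i - z (Fin.last d) i).det.natAbs, ?_⟩
  have h : edgeMatrix b = (Matrix.of fun i j : Fin d => z j.castSucc i - z (Fin.last d) i).map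
      (Int.castRingHom ℝ) := by
    ext i j
    simp [edgeMatrix, ← hz]
  rw [b.volume_real_convexHull, h, ← RingHom.mapMatrix_apply, ← RingHom.map_det]
  simp [Nat.cast_natAbs]

theorem finite_simplexVolumes {d k : ℕ} (hd : 1 ≤ d) (hk : 1 ≤ k) :
    (simplexVolumes d k).Finite := by
  set B := (k : ℝ) * ((d : ℝ) + 1) * ((sylvester d : ℝ) - 1) ^ 2 with hB
  refine ((Set.finite_Iic ⌊B⌋₊).image fun n : ℕ => (n : ℝ) / d.factorial).subset ?_
  rintro _ ⟨S, hS, rfl⟩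
  obtain ⟨n, hn⟩ := exists_nat_volume_real_eq hS
  refine ⟨n, Nat.le_floor ?_, hn.symm⟩
  have h := volume_real_le_of_mem_latticeSimplices hd hk hS
  rw [hn] at h
  exact (div_le_div_iff_of_pos_right (by positivity)).1 h

/-! ### The Zaks–Perles–Wills simplex -/

theorem affineIndependent_snoc_single_zero {d : ℕ} {c : Fin d → ℝ} (hc : ∀ i, c i ≠ 0) :
    AffineIndependent ℝ
      (Fin.snoc (fun i => Pi.single i (c i)) 0 : Fin (d + 1) → Fin d → ℝ) := by
  rw [affineIndependent_iff_of_fintype]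
  intro w hw h
  rw [Finset.univ.weightedVSub_eq_linear_combination hw, Fin.sum_univ_castSucc] at h
  have hcast : ∀ j : Fin d, w j.castSucc = 0 := by
    intro j
    have hj := congrFun h j
    simpa [Finset.sum_apply, Pi.single_apply, hc j] using hj
  intro i
  induction i using Fin.lastCases with
  | last => simpa [Fin.sum_univ_castSucc, hcast] using hw
  | cast j => exact hcast j

/-- The affine basis of `ℝ^d` formed by multiples of the standard basis vectors and the origin. -/
noncomputable def axisBasis {d : ℕ} (c : Fin d → ℝ) (hc : ∀ i, c i ≠ 0) :
    AffineBasis (Fin (d + 1)) ℝ (Fin d → ℝ) :=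
  ⟨_, affineIndependent_snoc_single_zero hc,
    (affineIndependent_snoc_single_zero hc).affineSpan_eq_top_iff_card_eq_finrank_add_one.2
      (by simp)⟩

section axisBasis

variable {d : ℕ} {c : Fin d → ℝ} (hc : ∀ i, c i ≠ 0)

theorem coe_axisBasis : ⇑(axisBasis c hc) = Fin.snoc (fun i => Pi.single i (c i)) 0 := rfl

theorem axisBasis_last : axisBasis c hc (Fin.last d) = 0 := by
  rw [coe_axisBasis, Fin.snoc_last]

theorem axisBasis_castSucc (i : Fin d) : axisBasis c hc i.castSucc = Pi.single i (c i) := by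
  rw [coe_axisBasis, Fin.snoc_castSucc]

theorem range_axisBasis :
    Set.range (axisBasis c hc) = insert 0 (Set.range fun i => Pi.single i (c i)) := by
  ext x
  simp only [Set.mem_range, Set.mem_insert_iff]
  constructor
  · rintro ⟨i, rfl⟩
    induction i using Fin.lastCases with
    | last => exact Or.inl (axisBasis_last hc)
    | cast j => exact Or.inr ⟨j, (axisBasis_castSucc hc j).symm⟩
  · rintro (rfl | ⟨j, rfl⟩)
    · exact ⟨_, axisBasis_last hc⟩
    · exact ⟨_, axisBasis_castSucc hc j⟩

theorem edgeMatrix_axisBasis : edgeMatrix (axisBasis c hc) = Matrix.diagonal c := by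
  ext i j
  rw [edgeMatrix, Matrix.of_apply, axisBasis_last, axisBasis_castSucc, Matrix.diagonal_apply]
  by_cases h : i = j
  · subst h; simp
  · simp [h]

theorem axisBasis_coord_castSucc (x : Fin d → ℝ) (i : Fin d) :
    (axisBasis c hc).coord i.castSucc x = x i / c i := by
  have h := congrFun ((axisBasis c hc).eq_add_edgeMatrix_mulVec x) i
  rw [edgeMatrix_axisBasis, axisBasis_last, zero_add, Matrix.mulVec_diagonal] at h
  rw [h, mul_div_cancel_left₀ _ (hc i)]

theorem axisBasis_coord_last (x : Fin d → ℝ) :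
    (axisBasis c hc).coord (Fin.last d) x = 1 - ∑ i, x i / c i := by
  have h := (axisBasis c hc).sum_coord_apply_eq_one x
  rw [Fin.sum_univ_castSucc] at h
  simp only [axisBasis_coord_castSucc] at h
  linarith

theorem mem_interior_convexHull_range_axisBasis (hpos : ∀ i, 0 < c i) {x : Fin d → ℝ} :
    x ∈ interior (convexHull ℝ (Set.range (axisBasis c hc))) ↔
      (∀ i, 0 < x i) ∧ ∑ i, x i / c i < 1 := by
  rw [(axisBasis c hc).interior_convexHull, Set.mem_ofPred_eq, Fin.forall_fin_succ',
    axisBasis_coord_last, sub_pos]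
  simp only [axisBasis_coord_castSucc]
  exact and_congr_left' (forall_congr' fun i => div_pos_iff_of_pos_right (hpos i))

end axisBasis

/-- The edge lengths of the Zaks–Perles–Wills simplex. -/
noncomputable def zpwEdge (D k : ℕ) : Fin (D + 1) → ℝ :=
  Fin.snoc (fun i : Fin D => (sylvester (i + 1) : ℝ)) ((k + 1) * sylvesterProd D)

theorem zpwEdge_castSucc (D k : ℕ) (i : Fin D) : zpwEdge D k i.castSucc = sylvester (i + 1) := by
  rw [zpwEdge, Fin.snoc_castSucc]

theorem zpwEdge_last (D k : ℕ) : zpwEdge D k (Fin.last D) = (k + 1) * sylvesterProd D := by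
  rw [zpwEdge, Fin.snoc_last]

theorem zpwEdge_pos (D k : ℕ) (i : Fin (D + 1)) : 0 < zpwEdge D k i := by
  induction i using Fin.lastCases with
  | last => rw [zpwEdge_last]; have := sylvesterProd_pos D; positivity
  | cast i => rw [zpwEdge_castSucc]; exact sylvester_cast_pos i

theorem zpwSimplex_eq (D k : ℕ) : zpwSimplex (D + 1) k = convexHull ℝ
    (Set.range (axisBasis (zpwEdge D k) fun i => (zpwEdge_pos D k i).ne')) := by
  rw [range_axisBasis, zpwSimplex]
  congr! 4 with i
  induction i using Fin.lastCases with
  | last => rw [zpwEdge_last, sylvester_succ]; simp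
  | cast i => rw [zpwEdge_castSucc]; simp [i.2.ne]

theorem volume_real_zpwSimplex (D k : ℕ) : volume.real (zpwSimplex (D + 1) k)
    = ((k : ℝ) + 1) * (sylvesterProd D : ℝ) ^ 2 / ((D + 1).factorial : ℝ) := by
  rw [zpwSimplex_eq, AffineBasis.volume_real_convexHull, edgeMatrix_axisBasis,
    Matrix.det_diagonal, Fin.prod_univ_castSucc, zpwEdge_last]
  simp only [zpwEdge_castSucc]
  rw [← Finset.prod_range fun i => (sylvester (i + 1) : ℝ), ← Nat.cast_prod, ← sylvesterProd,
    abs_of_nonneg (by positivity)]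
  ring

theorem sylvester_le_sylvesterProd {j D : ℕ} (hj : j < D) :
    sylvester (j + 1) ≤ sylvesterProd D :=
  Nat.le_of_dvd ((Nat.succ_pos D).trans_le (succ_le_sylvesterProd D))
    (Finset.dvd_prod_of_mem (fun i => sylvester (i + 1)) (Finset.mem_range.2 hj))

/-- Measuring the first D coordinates from 1 exposes the slack 1/P_D left by the Sylvester
reciprocals. -/
theorem sum_div_zpwEdge (D k : ℕ) (x : Fin (D + 1) → ℝ) : ∑ i, x i / zpwEdge D k i
    = 1 - 1 / sylvesterProd D + ∑ j : Fin D, (x j.castSucc - 1) / sylvester (j + 1)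
      + x (Fin.last D) / ((k + 1) * sylvesterProd D) := by
  rw [Fin.sum_univ_castSucc, zpwEdge_last, ← sum_inv_sylvester, Finset.sum_range,
    ← Finset.sum_add_distrib]
  congr 1
  refine Finset.sum_congr rfl fun j _ => ?_
  rw [zpwEdge_castSucc]
  ring

/-- An interior lattice point has all coordinates at least 1. If one of the first D were at least 2,
it would use 1/s_{j+1} ≥ 1/P_D, the entire slack, leaving nothing for the positive last term. So
they all equal 1, and the last runs over 1, …, k. -/
theorem interior_zpwSimplex_inter_latticePoints (D k : ℕ) :
    interior (zpwSimplex (D + 1) k) ∩ latticePoints (D + 1)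
      = Set.range fun t : Fin k => (Fin.snoc (fun _ => 1) ((t : ℝ) + 1) : Fin (D + 1) → ℝ) := by
  have hP := sylvesterProd_pos D
  ext x
  rw [Set.mem_inter_iff, zpwSimplex_eq,
    mem_interior_convexHull_range_axisBasis _ (zpwEdge_pos D k), sum_div_zpwEdge]
  constructor
  · rintro ⟨⟨hpos, hlt⟩, z, rfl⟩
    simp only at hpos hlt
    have hz : ∀ i, 1 ≤ z i := fun i => by exact_mod_cast hpos i
    have hnn : ∀ j : Fin D, 0 ≤ ((z j.castSucc : ℝ) - 1) / sylvester (j + 1) := fun j =>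
      div_nonneg (by have := hz j.castSucc; rw [sub_nonneg]; exact_mod_cast this)
        (Nat.cast_nonneg _)
    have hlast : 0 < (z (Fin.last D) : ℝ) / ((k + 1) * sylvesterProd D) :=
      div_pos (hpos _) (by positivity)
    have hone : ∀ j : Fin D, z j.castSucc = 1 := by
      intro j
      by_contra hne
      have h2 : 2 ≤ z j.castSucc := by have := hz j.castSucc; omega
      have h3 := Finset.single_le_sum (fun j _ => hnn j) (Finset.mem_univ j)
      have h4 : (1 : ℝ) / sylvesterProd D ≤ ((z j.castSucc : ℝ) - 1) / sylvester (j + 1) := by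
        have h5 : (sylvester (j + 1) : ℝ) ≤ sylvesterProd D := by
          exact_mod_cast sylvester_le_sylvesterProd j.2
        have h6 : (2 : ℝ) ≤ z j.castSucc := by exact_mod_cast h2
        have := sylvester_cast_pos j
        gcongr <;> linarith
      linarith
    have hsum : ∑ j : Fin D, ((z j.castSucc : ℝ) - 1) / sylvester (j + 1) = 0 :=
      Finset.sum_eq_zero fun j _ => by simp [hone]
    have hzk : z (Fin.last D) < k + 1 := by
      have h : (z (Fin.last D) : ℝ) / ((k + 1) * sylvesterProd D) < 1 / sylvesterProd D := by
        linarith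
      rw [div_lt_div_iff₀ (by positivity) hP, one_mul] at h
      exact_mod_cast lt_of_mul_lt_mul_right h hP.le
    have hz1 := hz (Fin.last D)
    refine ⟨⟨(z (Fin.last D) - 1).toNat, by omega⟩, ?_⟩
    funext i
    induction i using Fin.lastCases with
    | last =>
      simp only [Fin.snoc_last]
      have : (((z (Fin.last D) - 1).toNat : ℤ) : ℝ) = ((z (Fin.last D) - 1 : ℤ) : ℝ) := by
        rw [Int.toNat_of_nonneg (by omega)]
      rw [Int.cast_natCast] at this
      rw [this]
      push_cast
      ring
    | cast j => simp [hone]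
  · rintro ⟨t, rfl⟩
    refine ⟨⟨fun i => ?_, ?_⟩, Fin.snoc (fun _ => 1) ((t : ℤ) + 1), ?_⟩
    · induction i using Fin.lastCases with
      | last => simp only [Fin.snoc_last]; positivity
      | cast j => simp
    · simp only [Fin.snoc_castSucc, Fin.snoc_last, sub_self, zero_div, Finset.sum_const_zero,
        add_zero]
      have ht : (t : ℝ) + 1 < k + 1 := by
        have : ((t : ℕ) : ℝ) < k := by exact_mod_cast t.2
        linarith
      have : ((t : ℝ) + 1) / ((k + 1) * sylvesterProd D) < 1 / sylvesterProd D := by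
        rw [div_lt_div_iff₀ (by positivity) hP, one_mul]
        gcongr
      linarith
    · funext i
      induction i using Fin.lastCases with
      | last => simp
      | cast j => simp

theorem zpwSimplex_mem_latticeSimplices (D k : ℕ) :
    zpwSimplex (D + 1) k ∈ latticeSimplices (D + 1) k := by
  refine ⟨⟨⟨_, (axisBasis (zpwEdge D k) fun i => (zpwEdge_pos D k i).ne').ind⟩, fun i => ?_,
    zpwSimplex_eq D k⟩, ?_⟩
  · have hnat : ∀ i, ∃ n : ℕ, zpwEdge D k i = n := by
      intro i
      induction i using Fin.lastCases with
      | last => exact ⟨(k + 1) * sylvesterProd D, by rw [zpwEdge_last]; push_cast; rfl⟩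
      | cast j => exact ⟨_, zpwEdge_castSucc D k j⟩
    simp only
    induction i using Fin.lastCases with
    | last => rw [axisBasis_last]; exact (latticeSubgroup (D + 1)).zero_mem
    | cast j =>
      obtain ⟨n, hn⟩ := hnat j
      rw [axisBasis_castSucc, hn]
      refine ⟨Pi.single j (n : ℤ), ?_⟩
      ext i
      by_cases h : i = j
      · subst h; simp
      · simp [h]
  · rw [interior_zpwSimplex_inter_latticePoints, ← Set.image_univ, Function.Injective.encard_image,
      Set.encard_univ, ENat.card_eq_coe_fintype_card, Fintype.card_fin]
    intro t t' h
    have := congrFun h (Fin.last D)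
    simp only [Fin.snoc_last, add_left_inj, Nat.cast_inj] at this
    exact Fin.ext this

theorem theorem1p2 (d k : ℕ) (hd : 1 ≤ d) (hk : 1 ≤ k) :
    -- every lattice simplex with exactly `k` interior lattice points satisfies the volume bound
    (∀ S ∈ latticeSimplices d k,
      volume.real S ≤
        (k : ℝ) * ((d : ℝ) + 1) * ((sylvester d : ℝ) - 1) ^ 2 / (Nat.factorial d : ℝ)) ∧
    -- the maximum `s(d,k)` exists, and it satisfies the bound
    IsGreatest (simplexVolumes d k) (maxSimplexVolume d k) ∧
    maxSimplexVolume d k ≤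
      (k : ℝ) * ((d : ℝ) + 1) * ((sylvester d : ℝ) - 1) ^ 2 / (Nat.factorial d : ℝ) ∧
    -- comparison with the Zaks--Perles--Wills simplex
    zpwSimplex d k ∈ latticeSimplices d k ∧
    volume.real (zpwSimplex d k) =
      ((k : ℝ) + 1) * ((sylvester d : ℝ) - 1) ^ 2 / (Nat.factorial d : ℝ) ∧
    volume.real (zpwSimplex d k) ≤ maxSimplexVolume d k ∧
    maxSimplexVolume d k ≤ ((d : ℝ) + 1) * volume.real (zpwSimplex d k) := by
  have hbound : ∀ S ∈ latticeSimplices d k, _ :=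
    fun S hS => volume_real_le_of_mem_latticeSimplices hd hk hS
  have hfin := finite_simplexVolumes hd hk
  have hzpw : zpwSimplex d k ∈ latticeSimplices d k ∧ volume.real (zpwSimplex d k) =
      ((k : ℝ) + 1) * ((sylvester d : ℝ) - 1) ^ 2 / (Nat.factorial d : ℝ) := by
    obtain ⟨D, rfl⟩ := Nat.exists_eq_add_of_le' hd
    refine ⟨zpwSimplex_mem_latticeSimplices D k, ?_⟩
    rw [volume_real_zpwSimplex, sylvester_succ]
    push_cast
    ring
  have hzmem : volume.real (zpwSimplex d k) ∈ simplexVolumes d k := ⟨_, hzpw.1, rfl⟩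
  have hmem : maxSimplexVolume d k ∈ simplexVolumes d k :=
    Set.Nonempty.csSup_mem ⟨_, hzmem⟩ hfin
  have hgreatest : IsGreatest (simplexVolumes d k) (maxSimplexVolume d k) :=
    ⟨hmem, fun _ h => le_csSup hfin.bddAbove h⟩
  have hle : maxSimplexVolume d k ≤
      (k : ℝ) * ((d : ℝ) + 1) * ((sylvester d : ℝ) - 1) ^ 2 / (Nat.factorial d : ℝ) := by
    obtain ⟨S, hS, h⟩ := hmem
    rw [← h]
    exact hbound S hS
  refine ⟨hbound, hgreatest, hle, hzpw.1, hzpw.2, hgreatest.2 hzmem, hle.trans ?_⟩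
  rw [hzpw.2, ← mul_div_assoc]
  refine div_le_div_of_nonneg_right ?_ (Nat.cast_nonneg _)
  nlinarith [mul_nonneg (by positivity : (0 : ℝ) ≤ d + 1) (sq_nonneg ((sylvester d : ℝ) - 1))]
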